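/- **Theorem 1.4 (Narrow region principle in a union of finitely many narrow slabs).** Let $n\ge 1$, $0<s<1$, and write $x=(x',x_n)\in\mathbb{R}^n$. For $\lambda\in\mathbb{R}$ put $T_\lambda=\{x_n=\lambda\}$, $\Sigma_\lambda=\{x_n<\lambda\}$ and $x^\lambda=(x',2\lambda-x_n)$. Let $\mathcal L_{2s}$ be the set of $u\in L^1_{loc}(\mathbb{R}^n)$ with $\int_{\mathbb{R}^n}\frac{|u(x)|}{1+|x|^{n+2s}}\,dx<\infty$, and for $u\in\mathcal L_{2s}$ let $$(-\Delta)^su(x)=C_{n,s}\lim_{\varepsilon\to0^+}\int_{|x-y|\ge\varepsilon}\frac{u(x)-u(y)}{|x-y|^{n+2s}}\,dy,\qquad C_{n,s}=\frac{4^s\,\Gamma(\frac n2+s)}{\pi^{n/2}\,|\Gamma(-s)|}.$$ An equation for $(-\Delta)^su$ at a point $x$ includes the assertion that this limit exists (as it does, for instance, if $u$ is $C^{1,1}$ near $x$). For all $M\in\mathbb{R}$ and $d>0$ there is $l>0$, depending only on $n,s,M,d$, with the following property. Let $\lambda\in\mathbb{R}$, and let $\Omega\subset\Sigma_\lambda$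 be an open set with $$\Omega\subset\bigcup_{i=1}^N\{x\in\mathbb{R}^n: a_i<x_n<a_i+l_i\},\qquad l_i>0,$$ where any two different slabs of this finite union are at distance at least $d$ from each other. Let $c$ be a real function with $c\le M$ on $\Omega$. Let $w\in\mathcal L_{2s}$ be a real function on $\mathbb{R}^n$ that is lower semicontinuous on $\overline{\Sigma_\lambda}$ (for example, continuous) and satisfies $$\begin{cases}(-\Delta)^sw(x)=c(x)w(x), & x\in\Omega\cap\{w<0\},\\ w(x)\ge0, & x\in\Sigma_\lambda\setminus\Omega,\\ w(x)=-w(x^\lambda), & x\in\mathbb{R}^n,\end{cases}$$ and, for some constants $C_0\in\mathbb{R}$ and $0<\gamma<2s$, $$w(x)\ge -C_0(1+|x|^\gamma),\qquad x\in\Omega.$$ If $\max_{1\le i\le N} l_i<l$, then $w\ge 0$ in $\Sigma_\lambda$. Moreover, if in addition $w(\tilde x)=0$ at some point $\tilde x\in\Sigma_\lambda$ at which the equation $(-\Delta)^sw(\tilde x)=c(\tilde x)w(\tilde x)$ holds (for instance, some $\tilde x\in\Omega$, if the equation holds in all of $\Omega$), then $w\equiv0$ in $\mathbb{R}^n$.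 -/

import Mathlib

open MeasureTheory Filter Topology Set

noncomputable section

/-- The standard normalization constant
`C_{n,s} = 4^s Γ(n/2 + s) / (π^{n/2} |Γ(-s)|)` of the fractional Laplacian on `ℝⁿ`. -/
def fracLapConst (n : ℕ) (s : ℝ) : ℝ :=
  (4 : ℝ) ^ s * Real.Gamma ((n : ℝ) / 2 + s) /
    (Real.pi ^ ((n : ℝ) / 2) * |Real.Gamma (-s)|)

/-- The space `𝓛_{2s}` of locally integrable functions `u` on `ℝⁿ` with
`∫ |u(x)| / (1 + |x|^{n+2s}) dx < ∞`. -/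
def MemL2s {n : ℕ} (s : ℝ) (u : EuclideanSpace ℝ (Fin n) → ℝ) : Prop :=
  LocallyIntegrable u volume ∧
    Integrable (fun x : EuclideanSpace ℝ (Fin n) => |u x| / (1 + ‖x‖ ^ ((n : ℝ) + 2 * s))) volume

/-- `HasFracLaplacianAt s u x v`: the principal value defining `(-Δ)^s u (x)` exists and
equals `v`, that is
`C_{n,s} ∫_{|x-y| ≥ ε} (u(x) - u(y)) / |x-y|^{n+2s} dy → v` as `ε → 0⁺`.
(For `u ∈ 𝓛_{2s}` and `s > 0` all the truncated integrals converge absolutely.) -/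
def HasFracLaplacianAt {n : ℕ} (s : ℝ) (u : EuclideanSpace ℝ (Fin n) → ℝ)
    (x : EuclideanSpace ℝ (Fin n)) (v : ℝ) : Prop :=
  Tendsto
    (fun ε : ℝ => fracLapConst n s *
      ∫ y in (Metric.ball x ε)ᶜ, (u x - u y) / ‖x - y‖ ^ ((n : ℝ) + 2 * s))
    (𝓝[>] 0) (𝓝 v)

/-- The open half-space `Σ_lam = {x : x_n < lam}` of `ℝⁿ`, `n = m + 1`. -/
def lowerHalfSpace (m : ℕ) (lam : ℝ) : Set (EuclideanSpace ℝ (Fin (m + 1))) :=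
  {x | x (Fin.last m) < lam}

/-- The open slab `{x : a < x_n < a + l}` of `ℝⁿ`, `n = m + 1`. -/
def openSlab (m : ℕ) (a l : ℝ) : Set (EuclideanSpace ℝ (Fin (m + 1))) :=
  {x | a < x (Fin.last m) ∧ x (Fin.last m) < a + l}

/-- The reflection `x ↦ (x', 2 lam - x_n)` in the hyperplane `T_lam = {x : x_n = lam}`. -/
def planeReflection {m : ℕ} (lam : ℝ) (x : EuclideanSpace ℝ (Fin (m + 1))) :
    EuclideanSpace ℝ (Fin (m + 1)) :=
  WithLp.toLp 2 (fun i => if i = Fin.last m then 2 * lam - x i else x i)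

end

/-! Suppose `w` is negative somewhere in the half-space, and choose `p` with γ < 2p < 2s. Since `w /
G`, for `G = growthWeight η p`, cannot stay below a negative level at infinity, it attains a
negative minimum `-μ` at some `x₀ ∈ Ω`. The weight replaces the decay assumption that would
otherwise give a minimum of `w`.

With `g = 1_Ω G` and ρ the reflection, `u = w + μ (g - g ∘ ρ)` is antisymmetric, nonnegative in the
half-space and zero at `x₀`. Pairing `y` with `ρ y`, the kernel favours the nearer point, so `u`
contributes at most 0 to the fractional Laplacian of `w` at `x₀` (`antisymm_truncated_integral_ge`).
What remains is `-μ` times the integral of `G x₀ - g y` against the kernel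
(`fracLaplacian_le_of_min_div_growthWeight`). Two effects compete in it. Thin separated slabs leave
a ball of radius `l` outside `Ω` at distance comparable to `l` from `x₀`, which gains a multiple of
`G x₀ * l ^ (-2s)`. The growth of `G` costs at most `G x₀ * η ^ (2s) * A`
(`truncated_growthWeight_ge`), where `A` does not depend on `η`. Thus `l` is fixed by n, s, M, d
alone, and `η` is chosen afterwards to absorb the dependence on γ. The resulting inequality
contradicts `c ≤ M`.

For the rigidity statement the same pairing is kept quantitative: positivity of `w` on a small ball
makes the fractional Laplacian strictly negative at an interior zero. -/

/-- The slowly growing weight `(1 + η² |x|²)^p`. -/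
noncomputable def growthWeight {E : Type*} [NormedAddCommGroup E] (η p : ℝ) (x : E) : ℝ :=
  (1 + η ^ 2 * ‖x‖ ^ 2) ^ p

/-! ### Elementary inequalities for the growth weight -/

section GrowthWeight

variable {E : Type*} [NormedAddCommGroup E] {η p : ℝ}

lemma growthWeight_pos (x : E) : 0 < growthWeight η p x := by
  unfold growthWeight; positivity

lemma one_le_growthWeight (hp : 0 ≤ p) (x : E) : 1 ≤ growthWeight η p x :=
  Real.one_le_rpow (by nlinarith [mul_nonneg (sq_nonneg η) (sq_nonneg ‖x‖)]) hp

lemma continuous_growthWeight : Continuous (growthWeight η p : E → ℝ) := by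
  unfold growthWeight
  refine Continuous.rpow_const (by fun_prop) fun x => Or.inl ?_
  positivity

/-- The weight varies only at scale 1/η, so it is nearly constant between a point and the nearby
ball outside `Ω`. -/
lemma growthWeight_le_four_mul (hp0 : 0 ≤ p) (hp1 : p ≤ 1) {x y : E}
    (h : η ^ 2 * ‖x - y‖ ^ 2 ≤ 1) : growthWeight η p x ≤ 4 * growthWeight η p y := by
  unfold growthWeight
  have h1 : ‖x‖ ≤ ‖x - y‖ + ‖y‖ := by simpa using norm_add_le (x - y) y
  have h2 : ‖x‖ ^ 2 ≤ 2 * ‖x - y‖ ^ 2 + 2 * ‖y‖ ^ 2 := by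
    nlinarith [sq_nonneg (‖x - y‖ - ‖y‖), norm_nonneg x, norm_nonneg y, norm_nonneg (x - y)]
  have h3 : 1 + η ^ 2 * ‖x‖ ^ 2 ≤ 4 * (1 + η ^ 2 * ‖y‖ ^ 2) := by
    nlinarith [mul_le_mul_of_nonneg_left h2 (sq_nonneg η), mul_nonneg (sq_nonneg η) (sq_nonneg ‖y‖)]
  calc (1 + η ^ 2 * ‖x‖ ^ 2) ^ p ≤ (4 * (1 + η ^ 2 * ‖y‖ ^ 2)) ^ p :=
        Real.rpow_le_rpow (by positivity) h3 hp0
    _ = 4 ^ p * (1 + η ^ 2 * ‖y‖ ^ 2) ^ p := Real.mul_rpow (by norm_num) (by positivity)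
    _ ≤ 4 * (1 + η ^ 2 * ‖y‖ ^ 2) ^ p := by
        gcongr
        simpa using Real.rpow_le_rpow_of_exponent_le (x := 4) (by norm_num) hp1

lemma growthWeight_le_one_add_norm_rpow (hη0 : 0 ≤ η) (hη1 : η ≤ 1) (hp : 0 ≤ p) (x : E) :
    growthWeight η p x ≤ (1 + ‖x‖) ^ (2 * p) := by
  rw [Real.rpow_mul (by positivity), Real.rpow_two]
  refine Real.rpow_le_rpow (by positivity) ?_ hp
  have : η ^ 2 ≤ 1 := by nlinarith
  nlinarith [norm_nonneg x, mul_le_mul_of_nonneg_right this (sq_nonneg ‖x‖)]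

lemma rpow_le_growthWeight (hη0 : 0 ≤ η) (hp : 0 ≤ p) (x : E) :
    (η * ‖x‖) ^ (2 * p) ≤ growthWeight η p x := by
  rw [Real.rpow_mul (by positivity), Real.rpow_two]
  refine Real.rpow_le_rpow (by positivity) ?_ hp
  nlinarith

/-- Concavity of `t ^ p`, the parallelogram law, and 1 + a + b ≤ (1 + a)(1 + b). This bounds the
second difference of the weight by a multiple of its value at `x`, uniformly in `x`. -/
lemma growthWeight_midpoint_le [InnerProductSpace ℝ E] (hp0 : 0 ≤ p) (hp1 : p ≤ 1) (x z : E) :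
    growthWeight η p (x + z) + growthWeight η p (x - z) ≤
      2 * (growthWeight η p x * growthWeight η p z) := by
  unfold growthWeight
  have hc := (Real.concaveOn_rpow hp0 hp1).2
    (show (1 + η ^ 2 * ‖x + z‖ ^ 2) ∈ Ici (0 : ℝ) from by simp only [mem_Ici]; positivity)
    (show (1 + η ^ 2 * ‖x - z‖ ^ 2) ∈ Ici (0 : ℝ) from by simp only [mem_Ici]; positivity)
    (show (0 : ℝ) ≤ 1 / 2 by norm_num) (show (0 : ℝ) ≤ 1 / 2 by norm_num) (by norm_num)
  simp only [smul_eq_mul] at hc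
  have hpar := parallelogram_law_with_norm ℝ x z
  have h2 : 1 / 2 * (1 + η ^ 2 * ‖x + z‖ ^ 2) + 1 / 2 * (1 + η ^ 2 * ‖x - z‖ ^ 2)
      = 1 + η ^ 2 * (‖x‖ ^ 2 + ‖z‖ ^ 2) := by linear_combination (η ^ 2 / 2) * hpar
  rw [h2] at hc
  have h3 : (1 + η ^ 2 * (‖x‖ ^ 2 + ‖z‖ ^ 2)) ^ p ≤
      (1 + η ^ 2 * ‖x‖ ^ 2) ^ p * (1 + η ^ 2 * ‖z‖ ^ 2) ^ p := by
    rw [← Real.mul_rpow (by positivity) (by positivity)]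
    refine Real.rpow_le_rpow (by positivity) ?_ hp0
    have : 0 ≤ (η ^ 2 * ‖x‖ ^ 2) * (η ^ 2 * ‖z‖ ^ 2) := by positivity
    nlinarith
  linarith

end GrowthWeight

lemma one_add_sq_rpow_sub_one_le_sq {p t : ℝ} (hp1 : p ≤ 1) :
    (1 + t ^ 2) ^ p - 1 ≤ t ^ 2 := by
  have := Real.rpow_le_rpow_of_exponent_le (x := 1 + t ^ 2) (by nlinarith [sq_nonneg t]) hp1
  rw [Real.rpow_one] at this
  linarith

lemma one_add_sq_rpow_sub_one_le_rpow {p t : ℝ} (ht : 0 ≤ t) (hp0 : 0 ≤ p) (hp1 : p ≤ 1) :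
    (1 + t ^ 2) ^ p - 1 ≤ t ^ (2 * p) := by
  have := Real.rpow_add_le_add_rpow zero_le_one (sq_nonneg t) hp0 hp1
  rw [Real.rpow_mul ht, Real.rpow_two]
  rw [Real.one_rpow] at this
  linarith

/-! ### The cost integral of the weight and its scaling -/

section Kernel

variable {m : ℕ} {s p : ℝ}

/-- In polar coordinates the numerator is at most t² near 0, where s < 1 suffices, and at most
t^(2p) at infinity, where p < s suffices. -/
lemma integrable_growthWeight_sub_one_div (hs1 : s < 1) (hp0 : 0 < p) (hps : p < s) :
    Integrable (fun z : EuclideanSpace ℝ (Fin (m + 1)) =>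
      (growthWeight 1 p z - 1) / ‖z‖ ^ (((m + 1 : ℕ) : ℝ) + 2 * s)) volume := by
  unfold growthWeight
  simp only [one_pow, one_mul]
  refine (integrable_fun_norm_addHaar (volume : Measure (EuclideanSpace ℝ (Fin (m + 1))))
    (f := fun t : ℝ => ((1 + t ^ 2) ^ p - 1) / t ^ (((m + 1 : ℕ) : ℝ) + 2 * s))).2 ?_
  simp only [finrank_euclideanSpace, Fintype.card_fin, Nat.add_sub_cancel, smul_eq_mul]
  have hmeas : Measurable fun t : ℝ =>
      t ^ m * (((1 + t ^ 2) ^ p - 1) / t ^ (((m + 1 : ℕ) : ℝ) + 2 * s)) := by fun_prop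
  have hnn : ∀ t : ℝ, 0 ≤ (1 + t ^ 2) ^ p - 1 := fun t => by
    have := Real.one_le_rpow (x := 1 + t ^ 2) (by nlinarith [sq_nonneg t]) hp0.le
    linarith
  have hrew : ∀ t : ℝ, 0 < t → ∀ r : ℝ,
      t ^ m * (t ^ r / t ^ (((m + 1 : ℕ) : ℝ) + 2 * s)) = t ^ (r - 1 - 2 * s) := by
    intro t ht r
    rw [← Real.rpow_natCast, ← Real.rpow_sub ht, ← Real.rpow_add ht]
    congr 1
    push_cast
    ring
  rw [← Ioc_union_Ioi_eq_Ioi zero_le_one]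
  refine IntegrableOn.union ?_ ?_
  · have h1 : IntegrableOn (fun t : ℝ => t ^ (2 - 1 - 2 * s)) (Ioc 0 1) := by
      rw [← intervalIntegrable_iff_integrableOn_Ioc_of_le zero_le_one]
      exact intervalIntegral.intervalIntegrable_rpow' (by linarith)
    refine Integrable.mono' h1 hmeas.aestronglyMeasurable ?_
    refine (ae_restrict_mem measurableSet_Ioc).mono fun t ht => ?_
    have ht0 : 0 < t := ht.1
    rw [Real.norm_of_nonneg (by have := hnn t; positivity), ← hrew t ht0, Real.rpow_two]
    gcongr
    exact one_add_sq_rpow_sub_one_le_sq (by linarith)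
  · have h1 : IntegrableOn (fun t : ℝ => t ^ (2 * p - 1 - 2 * s)) (Ioi 1) :=
      integrableOn_Ioi_rpow_of_lt (by linarith) zero_lt_one
    refine Integrable.mono' h1 hmeas.aestronglyMeasurable ?_
    refine (ae_restrict_mem measurableSet_Ioi).mono fun t ht => ?_
    have ht0 : 0 < t := zero_lt_one.trans ht
    rw [Real.norm_of_nonneg (by have := hnn t; positivity), ← hrew t ht0]
    gcongr
    exact one_add_sq_rpow_sub_one_le_rpow ht0.le hp0.le (by linarith)

lemma growthWeight_smul_one_sub_one_div {η : ℝ} (hη : 0 < η)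
    (z : EuclideanSpace ℝ (Fin (m + 1))) :
    (growthWeight η p z - 1) / ‖z‖ ^ (((m + 1 : ℕ) : ℝ) + 2 * s) =
      η ^ (((m + 1 : ℕ) : ℝ) + 2 * s) *
        ((growthWeight 1 p (η • z) - 1) / ‖η • z‖ ^ (((m + 1 : ℕ) : ℝ) + 2 * s)) := by
  have h1 : growthWeight 1 p (η • z) = growthWeight η p z := by
    simp [growthWeight, norm_smul, mul_pow]
  rw [h1, norm_smul, Real.norm_of_nonneg hη.le, Real.mul_rpow hη.le (norm_nonneg z), ← mul_div_assoc,
    mul_div_mul_left _ _ (by positivity)]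

lemma integrable_growthWeight_sub_one_div' {η : ℝ} (hη : 0 < η) (hs1 : s < 1) (hp0 : 0 < p)
    (hps : p < s) :
    Integrable (fun z : EuclideanSpace ℝ (Fin (m + 1)) =>
      (growthWeight η p z - 1) / ‖z‖ ^ (((m + 1 : ℕ) : ℝ) + 2 * s)) volume := by
  simp_rw [growthWeight_smul_one_sub_one_div hη]
  exact ((integrable_growthWeight_sub_one_div hs1 hp0 hps).comp_smul hη.ne').const_mul _

lemma integral_growthWeight_sub_one_div {η : ℝ} (hη : 0 < η) :
    ∫ z : EuclideanSpace ℝ (Fin (m + 1)),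
        (growthWeight η p z - 1) / ‖z‖ ^ (((m + 1 : ℕ) : ℝ) + 2 * s) =
      η ^ (2 * s) * ∫ z : EuclideanSpace ℝ (Fin (m + 1)),
        (growthWeight 1 p z - 1) / ‖z‖ ^ (((m + 1 : ℕ) : ℝ) + 2 * s) := by
  simp_rw [growthWeight_smul_one_sub_one_div hη]
  rw [integral_const_mul, Measure.integral_comp_smul volume (fun z : EuclideanSpace ℝ (Fin (m + 1)) =>
    (growthWeight 1 p z - 1) / ‖z‖ ^ (((m + 1 : ℕ) : ℝ) + 2 * s)), smul_eq_mul, ← mul_assoc,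
    Real.rpow_add hη, abs_of_pos (by positivity), finrank_euclideanSpace, Fintype.card_fin,
    Real.rpow_natCast]
  congr 1
  field_simp

end Kernel

/-! ### The space `MemL2s` and truncated kernel integrals -/

section Weighted

variable {m : ℕ} {s : ℝ}

lemma MemL2s.add {u v : EuclideanSpace ℝ (Fin (m + 1)) → ℝ}
    (hu : MemL2s s u) (hv : MemL2s s v) : MemL2s s (fun x => u x + v x) := by
  refine ⟨hu.1.add hv.1, (hu.2.add hv.2).mono' ?_ (ae_of_all _ fun x => ?_)⟩
  · exact ((hu.1.add hv.1).aestronglyMeasurable.norm.aemeasurable.div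
      (by fun_prop)).aestronglyMeasurable
  · rw [Real.norm_of_nonneg (by positivity), Pi.add_apply, ← add_div]
    gcongr
    exact abs_add_le _ _

lemma MemL2s.const_mul {u : EuclideanSpace ℝ (Fin (m + 1)) → ℝ} (c : ℝ)
    (hu : MemL2s s u) : MemL2s s (fun x => c * u x) := by
  refine ⟨hu.1.smul c, ?_⟩
  convert hu.2.const_mul |c| using 2 with x
  rw [abs_mul, mul_div_assoc]

/-- Measurable functions growing at most like `|x|^r`, `r < 2s`, belong to `𝓛_{2s}`. -/
lemma memL2s_of_abs_le {u : EuclideanSpace ℝ (Fin (m + 1)) → ℝ} {C r : ℝ} (hs : 0 < s)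
    (hr0 : 0 ≤ r) (hr : r < 2 * s) (hu : Measurable u) (hle : ∀ x, |u x| ≤ C * (1 + ‖x‖) ^ r) :
    MemL2s s u := by
  have hC : 0 ≤ C := by simpa using (abs_nonneg _).trans (hle 0)
  constructor
  · have hc : Continuous fun x : EuclideanSpace ℝ (Fin (m + 1)) => C * (1 + ‖x‖) ^ r :=
      continuous_const.mul (Continuous.rpow_const (by fun_prop) fun x => Or.inr hr0)
    exact hc.locallyIntegrable.mono hu.aestronglyMeasurable
      (ae_of_all _ fun x => (hle x).trans (le_abs_self _))
  set q : ℝ := ((m + 1 : ℕ) : ℝ) + 2 * s with hq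
  have hq0 : 0 < q := by positivity
  have hint := ((integrable_one_add_norm (E := EuclideanSpace ℝ (Fin (m + 1))) (μ := volume)
    (r := q - r) (by simp only [finrank_euclideanSpace, Fintype.card_fin]; linarith)).const_mul
      (C * 2 ^ q))
  refine hint.mono' (Measurable.aestronglyMeasurable (by fun_prop)) (ae_of_all _ fun x => ?_)
  rw [Real.norm_of_nonneg (by positivity), div_le_iff₀ (by positivity)]
  have h1 : (1 + ‖x‖) ^ q ≤ 2 ^ q * (1 + ‖x‖ ^ q) := by
    have : (0 : ℝ) ≤ 2 ^ q := by positivity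
    rcases le_total ‖x‖ 1 with h | h
    · calc (1 + ‖x‖) ^ q ≤ 2 ^ q := Real.rpow_le_rpow (by positivity) (by linarith) hq0.le
        _ ≤ _ := by nlinarith [Real.rpow_nonneg (norm_nonneg x) q]
    · calc (1 + ‖x‖) ^ q ≤ (2 * ‖x‖) ^ q :=
            Real.rpow_le_rpow (by positivity) (by linarith) hq0.le
        _ = 2 ^ q * ‖x‖ ^ q := Real.mul_rpow (by norm_num) (norm_nonneg x)
        _ ≤ _ := by nlinarith
  have h2 : (1 + ‖x‖) ^ r = (1 + ‖x‖) ^ (-(q - r)) * (1 + ‖x‖) ^ q := by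
    rw [← Real.rpow_add (by positivity)]; congr 1; ring
  calc |u x| ≤ C * (1 + ‖x‖) ^ r := hle x
    _ = C * (1 + ‖x‖) ^ (-(q - r)) * (1 + ‖x‖) ^ q := by rw [h2]; ring
    _ ≤ C * (1 + ‖x‖) ^ (-(q - r)) * (2 ^ q * (1 + ‖x‖ ^ q)) := by gcongr
    _ = _ := by ring

lemma memL2s_const (hs : 0 < s) (c : ℝ) :
    MemL2s s (fun _ : EuclideanSpace ℝ (Fin (m + 1)) => c) :=
  memL2s_of_abs_le (C := |c|) (r := 0) hs le_rfl (by linarith) measurable_const (by simp)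

/-- Functions in `𝓛_{2s}` are integrable against the kernel away from its singularity. -/
lemma MemL2s.integrableOn_div {u : EuclideanSpace ℝ (Fin (m + 1)) → ℝ} (hs : 0 < s)
    (hu : MemL2s s u) (x : EuclideanSpace ℝ (Fin (m + 1))) {ε : ℝ} (hε : 0 < ε) :
    IntegrableOn (fun y => u y / ‖x - y‖ ^ (((m + 1 : ℕ) : ℝ) + 2 * s))
      (Metric.ball x ε)ᶜ volume := by
  set q : ℝ := ((m + 1 : ℕ) : ℝ) + 2 * s with hq
  have hq0 : 0 < q := by positivity
  -- The two summands of `K` control the terms 1 and `‖y‖ ^ q` of the weight, using `ε ≤ ‖x - y‖`.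
  set K : ℝ := (ε ^ q)⁻¹ + (‖x‖ / ε + 1) ^ q with hK
  refine (hu.2.const_mul K).integrableOn.mono' ?_ ?_
  · exact (hu.1.aestronglyMeasurable.aemeasurable.div
      (by fun_prop)).aestronglyMeasurable.restrict
  refine (ae_restrict_mem Metric.isOpen_ball.measurableSet.compl).mono fun y hy => ?_
  have hd : ε ≤ ‖x - y‖ := by
    simpa [dist_eq_norm, norm_sub_rev] using hy
  have hd0 : 0 < ‖x - y‖ := hε.trans_le hd
  rw [norm_div, Real.norm_eq_abs, Real.norm_of_nonneg (by positivity), ← hq, mul_div_assoc',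
    div_le_div_iff₀ (by positivity) (by positivity)]
  have h1 : 1 ≤ (ε ^ q)⁻¹ * ‖x - y‖ ^ q := by
    rw [inv_mul_eq_div, one_le_div (by positivity)]
    exact Real.rpow_le_rpow hε.le hd hq0.le
  have h2 : ‖y‖ ^ q ≤ (‖x‖ / ε + 1) ^ q * ‖x - y‖ ^ q := by
    rw [← Real.mul_rpow (by positivity) (by positivity)]
    refine Real.rpow_le_rpow (norm_nonneg y) ?_ hq0.le
    have h3 : ‖y‖ ≤ ‖x‖ + ‖x - y‖ := by
      have := norm_sub_le x (x - y); simpa using this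
    have h4 : ‖x‖ ≤ ‖x‖ / ε * ‖x - y‖ := by
      rw [div_mul_eq_mul_div, le_div_iff₀ hε]
      gcongr
    linarith
  calc |u y| * (1 + ‖y‖ ^ q)
      ≤ |u y| * ((ε ^ q)⁻¹ * ‖x - y‖ ^ q + (‖x‖ / ε + 1) ^ q * ‖x - y‖ ^ q) := by gcongr
    _ = _ := by rw [hK]; ring

end Weighted

/-! ### Fractional Laplacian of the growth weight -/

section Comparison

variable {m : ℕ} {s p η : ℝ}

lemma memL2s_growthWeight (hs0 : 0 < s) (hη0 : 0 ≤ η) (hη1 : η ≤ 1) (hp0 : 0 < p) (hps : p < s) :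
    MemL2s s (growthWeight η p : EuclideanSpace ℝ (Fin (m + 1)) → ℝ) := by
  refine memL2s_of_abs_le (C := 1) (r := 2 * p) hs0 (by linarith) (by linarith)
    continuous_growthWeight.measurable fun x => ?_
  rw [abs_of_pos (growthWeight_pos x), one_mul]
  exact growthWeight_le_one_add_norm_rpow hη0 hη1 hp0.le x

/-- The truncated fractional Laplacian of the weight is not too negative, uniformly in the
truncation. -/
lemma truncated_growthWeight_ge (hs0 : 0 < s) (hs1 : s < 1) (hη0 : 0 < η) (hη1 : η ≤ 1)
    (hp0 : 0 < p) (hps : p < s) (x : EuclideanSpace ℝ (Fin (m + 1))) {ε : ℝ} (hε : 0 < ε) :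
    -(growthWeight η p x * (η ^ (2 * s) * ∫ z : EuclideanSpace ℝ (Fin (m + 1)),
        (growthWeight 1 p z - 1) / ‖z‖ ^ (((m + 1 : ℕ) : ℝ) + 2 * s))) ≤
      ∫ y in (Metric.ball x ε)ᶜ,
        (growthWeight η p x - growthWeight η p y) / ‖x - y‖ ^ (((m + 1 : ℕ) : ℝ) + 2 * s) := by
  rw [← integral_growthWeight_sub_one_div hη0]
  set q : ℝ := ((m + 1 : ℕ) : ℝ) + 2 * s with hq
  set G : EuclideanSpace ℝ (Fin (m + 1)) → ℝ := growthWeight η p with hG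
  set φ : EuclideanSpace ℝ (Fin (m + 1)) → ℝ :=
    (Metric.ball x ε)ᶜ.indicator (fun y => (G x - G y) / ‖x - y‖ ^ q) with hφ
  have hms : MeasurableSet (Metric.ball x ε)ᶜ := Metric.isOpen_ball.measurableSet.compl
  have hφi : Integrable φ volume := by
    rw [hφ, integrable_indicator_iff hms]
    have := ((memL2s_const hs0 (G x)).add
      ((memL2s_growthWeight (m := m) hs0 hη0.le hη1 hp0 hps).const_mul (-1))).integrableOn_div hs0 x hε
    refine this.congr (ae_of_all _ fun y => ?_)
    simp only [hG, neg_mul, one_mul, sub_eq_add_neg, hq]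
  rw [← integral_indicator hms]
  -- Averaging over `z` and `-z` turns first differences into second differences, to which the
  -- midpoint inequality applies.
  have e1 : ∫ z, φ (x + z) = ∫ y, φ y := integral_add_left_eq_self φ x
  have e2 : ∫ z, φ (x - z) = ∫ y, φ y := integral_sub_left_eq_self φ volume x
  have i1 : Integrable (fun z => φ (x + z)) volume := hφi.comp_add_left x
  have i2 : Integrable (fun z => φ (x - z)) volume := hφi.comp_sub_left x
  have key : ∫ z, -(2 * G x * ((G z - 1) / ‖z‖ ^ q)) ≤ ∫ z, (φ (x + z) + φ (x - z)) := by
    refine integral_mono ?_ (i1.add i2) fun z => ?_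
    · exact ((integrable_growthWeight_sub_one_div' hη0 hs1 hp0 hps).const_mul _).neg
    have hz : 0 ≤ (G z - 1) / ‖z‖ ^ q :=
      div_nonneg (sub_nonneg.2 (one_le_growthWeight hp0.le z)) (by positivity)
    have hx := growthWeight_pos (η := η) (p := p) x
    simp only [hφ, indicator, mem_compl_iff, Metric.mem_ball, dist_eq_norm, add_sub_cancel_left,
      sub_sub_cancel_left, norm_neg, sub_add_cancel_left, sub_sub_cancel]
    by_cases h : ‖z‖ < ε
    · simp only [h, not_true_eq_false, if_false]
      have : 0 ≤ G x * ((G z - 1) / ‖z‖ ^ q) := mul_nonneg hx.le hz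
      linarith
    · simp only [h, not_false_eq_true, if_true]
      rw [← add_div, mul_div_assoc', ← neg_div]
      gcongr
      have := growthWeight_midpoint_le (η := η) hp0.le (by linarith) x z
      rw [← hG] at this
      nlinarith
  rw [integral_add i1 i2, e1, e2, integral_neg, integral_const_mul] at key
  linarith

end Comparison

/-! ### Reflection in the hyperplane -/

section Reflection

variable {m : ℕ} {lam : ℝ}

lemma planeReflection_apply (x : EuclideanSpace ℝ (Fin (m + 1))) (i : Fin (m + 1)) :
    planeReflection lam x i = if i = Fin.last m then 2 * lam - x i else x i := rfl

lemma planeReflection_last (x : EuclideanSpace ℝ (Fin (m + 1))) :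
    planeReflection lam x (Fin.last m) = 2 * lam - x (Fin.last m) := by
  simp [planeReflection_apply]

lemma planeReflection_planeReflection (x : EuclideanSpace ℝ (Fin (m + 1))) :
    planeReflection lam (planeReflection lam x) = x := by
  ext i
  by_cases h : i = Fin.last m <;> simp [planeReflection_apply, h]

lemma planeReflection_eq_self {x : EuclideanSpace ℝ (Fin (m + 1))} (h : x (Fin.last m) = lam) :
    planeReflection lam x = x := by
  ext i
  by_cases hi : i = Fin.last m
  · subst hi; rw [planeReflection_last]; linarith
  · simp [planeReflection_apply, hi]

/-- The reflection is the composition of a linear isometry and a translation. -/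
lemma planeReflection_eq_isometry_add :
    ∃ R : EuclideanSpace ℝ (Fin (m + 1)) ≃ₗᵢ[ℝ] EuclideanSpace ℝ (Fin (m + 1)),
      ∀ x, planeReflection lam x = R x + EuclideanSpace.single (Fin.last m) (2 * lam) := by
  refine ⟨LinearIsometryEquiv.piLpCongrRight 2 fun i =>
    if i = Fin.last m then LinearIsometryEquiv.neg ℝ else LinearIsometryEquiv.refl ℝ ℝ, fun x => ?_⟩
  ext i
  by_cases h : i = Fin.last m
  · subst h; simp [planeReflection_apply]; ring
  · simp [planeReflection_apply, h]

lemma measurePreserving_planeReflection :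
    MeasurePreserving (planeReflection (m := m) lam) volume volume := by
  obtain ⟨R, hR⟩ := planeReflection_eq_isometry_add (m := m) (lam := lam)
  rw [funext hR]
  exact (measurePreserving_add_right volume _).comp R.measurePreserving

lemma dist_planeReflection (x y : EuclideanSpace ℝ (Fin (m + 1))) :
    dist (planeReflection lam x) (planeReflection lam y) = dist x y := by
  obtain ⟨R, hR⟩ := planeReflection_eq_isometry_add (m := m) (lam := lam)
  rw [hR, hR, dist_add_right, R.dist_map]

lemma isometry_planeReflection : Isometry (planeReflection (m := m) lam) :=
  Isometry.of_dist_eq dist_planeReflection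

lemma measurableEmbedding_planeReflection :
    MeasurableEmbedding (planeReflection (m := m) lam) :=
  (isometry_planeReflection.isClosedEmbedding).measurableEmbedding

lemma norm_sub_planeReflection_sq (x y : EuclideanSpace ℝ (Fin (m + 1))) :
    ‖x - planeReflection lam y‖ ^ 2 =
      ‖x - y‖ ^ 2 + 4 * (lam - x (Fin.last m)) * (lam - y (Fin.last m)) := by
  rw [EuclideanSpace.norm_sq_eq, EuclideanSpace.norm_sq_eq, Fin.sum_univ_castSucc,
    Fin.sum_univ_castSucc]
  have : ∀ i : Fin m, planeReflection lam y i.castSucc = y i.castSucc := fun i => by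
    simp [planeReflection_apply, (Fin.castSucc_lt_last i).ne]
  simp only [PiLp.sub_apply, this, planeReflection_last, Real.norm_eq_abs, sq_abs]
  ring

lemma norm_sub_lt_norm_sub_planeReflection {x y : EuclideanSpace ℝ (Fin (m + 1))}
    (hx : x (Fin.last m) < lam) (hy : y (Fin.last m) < lam) :
    ‖x - y‖ < ‖x - planeReflection lam y‖ := by
  refine lt_of_pow_lt_pow_left₀ 2 (norm_nonneg _) ?_
  rw [norm_sub_planeReflection_sq]
  nlinarith [mul_pos (sub_pos.2 hx) (sub_pos.2 hy)]

lemma sub_last_le_norm_sub_planeReflection (x : EuclideanSpace ℝ (Fin (m + 1)))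
    {y : EuclideanSpace ℝ (Fin (m + 1))} (hy : y (Fin.last m) ≤ lam) :
    lam - x (Fin.last m) ≤ ‖x - planeReflection lam y‖ := by
  have := PiLp.norm_apply_le (x - planeReflection lam y) (Fin.last m)
  rw [PiLp.sub_apply, planeReflection_last, Real.norm_eq_abs] at this
  have h2 := neg_abs_le (x (Fin.last m) - (2 * lam - y (Fin.last m)))
  linarith

lemma isOpen_lowerHalfSpace : IsOpen (lowerHalfSpace m lam) :=
  isOpen_lt (by fun_prop) continuous_const

lemma closure_lowerHalfSpace_subset :
    closure (lowerHalfSpace m lam) ⊆ {x | x (Fin.last m) ≤ lam} :=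
  closure_minimal (fun x hx => show x (Fin.last m) ≤ lam from le_of_lt hx) (isClosed_le (by fun_prop) continuous_const)

end Reflection

/-! ### Antisymmetric functions against the kernel -/

section Antisymmetric

variable {m : ℕ} {s lam : ℝ}

/-- Truncated kernel integrals, at a point of the half-space, of an antisymmetric function that is
nonnegative on the half-space. -/
lemma antisymm_truncated_integral_ge (hs0 : 0 < s) {v : EuclideanSpace ℝ (Fin (m + 1)) → ℝ}
    (hv : MemL2s s v) (hanti : ∀ x, v x = -v (planeReflection lam x))
    (hnn : ∀ x ∈ lowerHalfSpace m lam, 0 ≤ v x) {x : EuclideanSpace ℝ (Fin (m + 1))}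
    (hx : x ∈ lowerHalfSpace m lam) {ε ε₀ : ℝ} (hε : 0 < ε) (hεε₀ : ε ≤ ε₀)
    {D : Set (EuclideanSpace ℝ (Fin (m + 1)))} (hD : MeasurableSet D)
    (hDs : ∀ y ∈ D, planeReflection lam y ∈ D) (hDb : Disjoint D (Metric.ball x ε₀)) :
    (∫ y in D, v y * ((‖x - y‖ ^ (((m + 1 : ℕ) : ℝ) + 2 * s))⁻¹ -
          (‖x - planeReflection lam y‖ ^ (((m + 1 : ℕ) : ℝ) + 2 * s))⁻¹)) / 2 -
        ((lam - x (Fin.last m)) ^ (((m + 1 : ℕ) : ℝ) + 2 * s))⁻¹ *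
          ∫ y in Metric.ball x ε, |v y| ≤
      ∫ y in (Metric.ball x ε)ᶜ, v y / ‖x - y‖ ^ (((m + 1 : ℕ) : ℝ) + 2 * s) := by
  set q : ℝ := ((m + 1 : ℕ) : ℝ) + 2 * s with hq
  have hq0 : 0 < q := by positivity
  set ρ : EuclideanSpace ℝ (Fin (m + 1)) → EuclideanSpace ℝ (Fin (m + 1)) :=
    planeReflection lam with hρ
  have hx' : x (Fin.last m) < lam := hx
  have hδ : 0 < lam - x (Fin.last m) := sub_pos.2 hx'
  set δ := (lam - x (Fin.last m)) ^ q with hδq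
  have hδ0 : 0 < δ := by positivity
  have hρρ : ∀ y, ρ (ρ y) = y := planeReflection_planeReflection
  have hmp : MeasurePreserving ρ volume volume := measurePreserving_planeReflection
  have hme : MeasurableEmbedding ρ := measurableEmbedding_planeReflection
  have hmb : MeasurableSet (Metric.ball x ε) := Metric.isOpen_ball.measurableSet
  have hvρ : ∀ y, v (ρ y) = -v y := fun y => by rw [hanti y, neg_neg]
  set φ : EuclideanSpace ℝ (Fin (m + 1)) → ℝ :=
    (Metric.ball x ε)ᶜ.indicator fun y => v y / ‖x - y‖ ^ q with hφ
  have hφi : Integrable φ volume := (integrable_indicator_iff hmb.compl).2 (hv.integrableOn_div hs0 x hε)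
  -- The truncation ball is not reflection invariant. A point `y` inside it may have `ρ y` outside,
  -- leaving an unpaired negative term; `β` dominates that term and vanishes in the limit.
  set β : EuclideanSpace ℝ (Fin (m + 1)) → ℝ :=
    (Metric.ball x ε).indicator fun y => |v y| with hβ
  have hvb : IntegrableOn (fun y => |v y|) (Metric.ball x ε) volume :=
    ((hv.1.integrableOn_isCompact (isCompact_closedBall x ε)).mono_set
      Metric.ball_subset_closedBall).norm
  have hβi : Integrable β volume := (integrable_indicator_iff hmb).2 hvb
  have hDε : ∀ y ∈ D, ¬ ‖x - y‖ < ε := fun y hy h => disjoint_left.1 hDb hy (by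
    rw [Metric.mem_ball, dist_eq_norm, norm_sub_rev]; exact h.trans_le hεε₀)
  set ψ : EuclideanSpace ℝ (Fin (m + 1)) → ℝ :=
    D.indicator fun y => v y * ((‖x - y‖ ^ q)⁻¹ - (‖x - ρ y‖ ^ q)⁻¹) with hψ
  have hφρi : Integrable (fun y => φ (ρ y)) volume := hmp.integrable_comp_of_integrable hφi
  have hβρi : Integrable (fun y => β (ρ y)) volume := hmp.integrable_comp_of_integrable hβi
  have hψeq : ψ = D.indicator fun y => φ y + φ (ρ y) := by
    refine indicator_congr fun y hy => ?_
    have h1 := hDε y hy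
    have h2 := hDε _ (hDs y hy)
    simp only [hφ, indicator, mem_compl_iff, Metric.mem_ball, dist_eq_norm,
      norm_sub_rev _ x]
    rw [if_pos h1, if_pos h2, hvρ]
    ring
  have hψi : Integrable ψ volume := by
    rw [hψeq]; exact (hφi.add hφρi).indicator hD
  have hsum_symm : ∀ y, φ (ρ y) + φ (ρ (ρ y)) = φ y + φ (ρ y) := fun y => by rw [hρρ]; ring
  have hψ_symm : ∀ y, ψ (ρ y) = ψ y := fun y => by
    by_cases hy : y ∈ D
    · rw [hψeq, indicator_of_mem (hDs y hy), indicator_of_mem hy, hsum_symm]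
    · rw [hψeq, indicator_of_notMem (fun h => hy (by simpa only [hρρ] using hDs _ h)),
        indicator_of_notMem hy]
  -- It suffices to compare at or below the plane, since both sides are invariant under `ρ`.
  -- Integrating counts each of φ and β twice, hence the factor 1/2 on the `D` term.
  have hlow : ∀ y, y (Fin.last m) ≤ lam → ψ y - δ⁻¹ * (β y + β (ρ y)) ≤ φ y + φ (ρ y) := by
    intro y hy
    have hβnn : ∀ z, 0 ≤ β z := fun z => indicator_nonneg (fun _ _ => abs_nonneg _) z
    have hvy : 0 ≤ v y := by
      rcases hy.lt_or_eq with h | h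
      · exact hnn y h
      · have := hanti y
        rw [hρ, planeReflection_eq_self h] at this
        linarith
    have hkρ : (‖x - ρ y‖ ^ q)⁻¹ ≤ δ⁻¹ := by
      have := Real.rpow_le_rpow hδ.le (sub_last_le_norm_sub_planeReflection x hy) hq0.le
      exact inv_anti₀ hδ0 this
    by_cases hyD : y ∈ D
    · have h3 : ψ y = φ y + φ (ρ y) := by rw [hψeq, indicator_of_mem hyD]
      have : 0 ≤ δ⁻¹ * (β y + β (ρ y)) :=
        mul_nonneg (by positivity) (add_nonneg (hβnn _) (hβnn _))
      linarith
    have h0 : ψ y = 0 := indicator_of_notMem hyD _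
    have hxy : ‖x - y‖ ≤ ‖x - ρ y‖ := by
      rcases hy.lt_or_eq with h | h
      · exact (norm_sub_lt_norm_sub_planeReflection hx' h).le
      · rw [hρ, planeReflection_eq_self h]
    by_cases hyb : ‖x - y‖ < ε
    · have hb : β y = v y := by
        simp [hβ, dist_eq_norm, norm_sub_rev _ x, hyb, abs_of_nonneg hvy]
      have hf : φ y = 0 := by
        simp [hφ, dist_eq_norm, norm_sub_rev _ x, hyb]
      have hfρ : -(δ⁻¹ * v y) ≤ φ (ρ y) := by
        have h5 : 0 ≤ δ⁻¹ * v y := by positivity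
        simp only [hφ, indicator, hvρ]
        split_ifs
        · rw [neg_div, div_eq_inv_mul]
          gcongr
        · linarith
      have : 0 ≤ δ⁻¹ * β (ρ y) := mul_nonneg (by positivity) (hβnn _)
      rw [h0, hf, mul_add, hb]
      linarith
    · have hyb' : ¬ ‖x - ρ y‖ < ε := fun h => hyb (hxy.trans_lt h)
      have hsum : 0 ≤ φ y + φ (ρ y) := by
        simp only [hφ, indicator, mem_compl_iff, Metric.mem_ball, dist_eq_norm,
          norm_sub_rev _ x]
        rw [if_pos hyb, if_pos hyb', hvρ, neg_div, ← sub_eq_add_neg, sub_nonneg]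
        have : 0 < ‖x - y‖ := hε.trans_le (not_lt.1 hyb)
        gcongr
      have : 0 ≤ δ⁻¹ * (β y + β (ρ y)) :=
        mul_nonneg (by positivity) (add_nonneg (hβnn _) (hβnn _))
      linarith
  have hle : ∀ y, ψ y - δ⁻¹ * (β y + β (ρ y)) ≤ φ y + φ (ρ y) := by
    intro y
    rcases le_total (y (Fin.last m)) lam with h | h
    · exact hlow y h
    · have := hlow (ρ y) (by rw [hρ, planeReflection_last]; linarith)
      rwa [hψ_symm, hsum_symm, hρρ, add_comm (β (ρ y))] at this
  have hββi : Integrable (fun y => δ⁻¹ * (β y + β (ρ y))) volume := (hβi.add hβρi).const_mul δ⁻¹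
  have hint := integral_mono (hψi.sub hββi) (hφi.add hφρi) hle
  have e1 : ∫ y, φ (ρ y) = ∫ y, φ y := hmp.integral_comp hme φ
  have e2 : ∫ y, β (ρ y) = ∫ y, β y := hmp.integral_comp hme β
  simp only [Pi.add_apply, Pi.sub_apply] at hint
  rw [integral_sub hψi hββi, integral_const_mul, integral_add hβi hβρi, integral_add hφi hφρi, e1, e2] at hint
  rw [← integral_indicator hD, ← integral_indicator hmb, ← integral_indicator hmb.compl]
  linarith

/-- By antisymmetry the integrand is the sum of `v y / ‖x - y‖ ^ q`, with `q` the kernel exponent,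
and its composition with the reflection. -/
lemma antisymm_integrableOn (hs0 : 0 < s) {v : EuclideanSpace ℝ (Fin (m + 1)) → ℝ}
    (hv : MemL2s s v) (hanti : ∀ x, v x = -v (planeReflection lam x))
    {x : EuclideanSpace ℝ (Fin (m + 1))} {ε₀ : ℝ} (hε₀ : 0 < ε₀)
    {D : Set (EuclideanSpace ℝ (Fin (m + 1)))}
    (hDs : ∀ y ∈ D, planeReflection lam y ∈ D) (hDb : Disjoint D (Metric.ball x ε₀)) :
    IntegrableOn (fun y => v y * ((‖x - y‖ ^ (((m + 1 : ℕ) : ℝ) + 2 * s))⁻¹ -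
      (‖x - planeReflection lam y‖ ^ (((m + 1 : ℕ) : ℝ) + 2 * s))⁻¹)) D volume := by
  have h1 := (hv.integrableOn_div hs0 x hε₀).mono_set hDb.subset_compl_right
  have h2 := ((measurePreserving_planeReflection (m := m) (lam := lam)).integrableOn_comp_preimage
    measurableEmbedding_planeReflection).2 h1
  refine (h1.add (h2.mono_set hDs)).congr (ae_of_all _ fun y => ?_)
  have : v (planeReflection lam y) = -v y := by rw [hanti y, neg_neg]
  simp only [Pi.add_apply, Function.comp_apply, this]
  ring

/-- The integral of a locally integrable function over small balls tends to zero. -/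
lemma tendsto_setIntegral_abs_ball {v : EuclideanSpace ℝ (Fin (m + 1)) → ℝ}
    (hv : LocallyIntegrable v volume) (x : EuclideanSpace ℝ (Fin (m + 1))) :
    Tendsto (fun ε : ℝ => ∫ y in Metric.ball x ε, |v y|) (𝓝[>] 0) (𝓝 0) := by
  have hi : Integrable (fun y => |v y|) (volume.restrict (Metric.closedBall x 1)) :=
    (hv.integrableOn_isCompact (isCompact_closedBall x 1)).norm
  have hs : Tendsto (fun ε : ℝ => (volume.restrict (Metric.closedBall x 1)) (Metric.ball x ε))
      (𝓝[>] 0) (𝓝 0) := by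
    have h0 : Tendsto (fun ε : ℝ => ENNReal.ofReal (ε ^ (m + 1)) *
        volume (Metric.ball (0 : EuclideanSpace ℝ (Fin (m + 1))) 1)) (𝓝[>] 0) (𝓝 0) := by
      have h1 : Tendsto (fun ε : ℝ => ENNReal.ofReal (ε ^ (m + 1))) (𝓝[>] 0) (𝓝 0) := by
        have : Continuous fun ε : ℝ => ENNReal.ofReal (ε ^ (m + 1)) :=
          ENNReal.continuous_ofReal.comp (continuous_pow _)
        simpa using (this.tendsto 0).mono_left nhdsWithin_le_nhds
      simpa using ENNReal.Tendsto.mul_const h1 (Or.inr measure_ball_lt_top.ne)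
    refine tendsto_of_tendsto_of_tendsto_of_le_of_le' tendsto_const_nhds h0
      (Eventually.of_forall fun _ => zero_le) ?_
    filter_upwards [self_mem_nhdsWithin] with ε hε
    refine (Measure.restrict_apply_le _ _).trans ?_
    rw [Measure.addHaar_ball_of_pos volume x hε, finrank_euclideanSpace, Fintype.card_fin]
  refine (hi.tendsto_setIntegral_nhds_zero hs).congr' ?_
  filter_upwards [Ioc_mem_nhdsGT (zero_lt_one' ℝ)] with ε hε
  rw [Measure.restrict_restrict Metric.isOpen_ball.measurableSet, inter_eq_left.2
    ((Metric.ball_subset_ball hε.2).trans Metric.ball_subset_closedBall)]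

end Antisymmetric

lemma fracLapConst_pos {n : ℕ} {s : ℝ} (hs0 : 0 < s) (hs1 : s < 1) : 0 < fracLapConst n s := by
  unfold fracLapConst
  have h1 : 0 < Real.Gamma ((n : ℝ) / 2 + s) := Real.Gamma_pos_of_pos (by positivity)
  have h2 : Real.Gamma (-s) ≠ 0 := Real.Gamma_ne_zero fun k hk => by
    have hk' : s = k := neg_injective hk
    have h0 : 0 < k := by exact_mod_cast hk' ▸ hs0
    have h1 : k < 1 := by exact_mod_cast hk' ▸ hs1
    omega
  positivity

/-! ### Negative minimum of the quotient and geometry of thin slabs -/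

section NarrowRegion

variable {m : ℕ} {s lam : ℝ}

/-- The quotient of `w` by a faster growing weight attains its negative minimum. -/
lemma exists_min_div_growthWeight {p η γ C₀ : ℝ} (hη : 0 < η) (hγp : γ < 2 * p) (hγ : 0 < γ)
    {Ω : Set (EuclideanSpace ℝ (Fin (m + 1)))} {w : EuclideanSpace ℝ (Fin (m + 1)) → ℝ}
    (hlsc : LowerSemicontinuousOn w (closure (lowerHalfSpace m lam)))
    (hanti : ∀ x, w x = -w (planeReflection lam x))
    (hout : ∀ x ∈ lowerHalfSpace m lam \ Ω, 0 ≤ w x)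
    (hgrow : ∀ x ∈ Ω, -C₀ * (1 + ‖x‖ ^ γ) ≤ w x)
    {x₁ : EuclideanSpace ℝ (Fin (m + 1))} (hx₁ : x₁ ∈ lowerHalfSpace m lam) (hw₁ : w x₁ < 0) :
    ∃ x₀ ∈ Ω, w x₀ < 0 ∧
      ∀ y ∈ lowerHalfSpace m lam, w x₀ / growthWeight η p x₀ ≤ w y / growthWeight η p y := by
  have hp : 0 < p := by linarith
  set G : EuclideanSpace ℝ (Fin (m + 1)) → ℝ := growthWeight η p with hG
  have hGpos : ∀ x, 0 < G x := growthWeight_pos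
  set τ := w x₁ / G x₁ with hτ
  have hτ0 : τ < 0 := div_neg_of_neg_of_pos hw₁ (hGpos _)
  -- Since γ < 2p, the weight outgrows the lower bound on `w`, so far points of `Ω` cannot beat the
  -- value at `x₁`.
  obtain ⟨R, hR⟩ : ∃ R : ℝ, ∀ y ∈ Ω, R ≤ ‖y‖ → τ ≤ w y / G y := by
    have ht : Tendsto (fun t : ℝ => |C₀| * (t ^ (-(2 * p)) + t ^ (-(2 * p - γ)))) atTop (𝓝 0) := by
      simpa using ((tendsto_rpow_neg_atTop (y := 2 * p) (by linarith)).add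
        (tendsto_rpow_neg_atTop (y := 2 * p - γ) (by linarith))).const_mul |C₀|
    have hpos : 0 < -τ * η ^ (2 * p) := mul_pos (by linarith) (by positivity)
    obtain ⟨R, hR⟩ := eventually_atTop.1
      ((ht.eventually_lt_const hpos).and (eventually_gt_atTop 0))
    refine ⟨R, fun y hy hRy => ?_⟩
    obtain ⟨h1, h0⟩ := hR _ hRy
    rw [le_div_iff₀ (hGpos y)]
    have h2 : |C₀| * (1 + ‖y‖ ^ γ) ≤ -τ * (η * ‖y‖) ^ (2 * p) := by
      have h3 := mul_le_mul_of_nonneg_right h1.le (Real.rpow_nonneg h0.le (2 * p))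
      have h4 : ‖y‖ ^ (-(2 * p)) * ‖y‖ ^ (2 * p) = 1 := by
        rw [← Real.rpow_add h0]; simp
      have h5 : ‖y‖ ^ (-(2 * p - γ)) * ‖y‖ ^ (2 * p) = ‖y‖ ^ γ := by
        rw [← Real.rpow_add h0]; congr 1; ring
      rw [Real.mul_rpow hη.le h0.le]
      calc _ = |C₀| * (‖y‖ ^ (-(2 * p)) * ‖y‖ ^ (2 * p)
            + ‖y‖ ^ (-(2 * p - γ)) * ‖y‖ ^ (2 * p)) := by rw [h4, h5]
        _ ≤ _ := by linarith
    have h6 : (η * ‖y‖) ^ (2 * p) ≤ G y := rpow_le_growthWeight hη.le hp.le y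
    have h7 : C₀ * (1 + ‖y‖ ^ γ) ≤ |C₀| * (1 + ‖y‖ ^ γ) :=
      mul_le_mul_of_nonneg_right (le_abs_self _) (by positivity)
    have h8 : -τ * (η * ‖y‖) ^ (2 * p) ≤ -τ * G y :=
      mul_le_mul_of_nonneg_left h6 (by linarith)
    have := hgrow y hy
    linarith
  set K := closure (lowerHalfSpace m lam) ∩ Metric.closedBall 0 (max R ‖x₁‖) with hK
  have hKc : IsCompact K := (isCompact_closedBall _ _).inter_left isClosed_closure
  have hx₁K : x₁ ∈ K := ⟨subset_closure hx₁, by simp⟩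
  have hqlsc : LowerSemicontinuousOn (fun y => w y / G y) K := by
    intro x hx t ht
    simp only [lt_div_iff₀ (hGpos _)] at ht ⊢
    have hc : Continuous fun y => -(t * G y) := (continuous_const.mul continuous_growthWeight).neg
    have := (hlsc.mono inter_subset_left).add (hc.lowerSemicontinuous.lowerSemicontinuousOn K)
    filter_upwards [this x hx 0 (by linarith)] with y hy
    linarith
  obtain ⟨x₀, hx₀K, hmin⟩ := hqlsc.exists_isMinOn ⟨x₁, hx₁K⟩ hKc
  have hle₁ : w x₀ / G x₀ ≤ τ := hmin hx₁K
  have hw₀ : w x₀ < 0 := by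
    by_contra h
    have := div_nonneg (not_lt.1 h) (hGpos x₀).le
    linarith
  -- On the hyperplane itself antisymmetry forces `w = 0`.
  have hx₀S : x₀ ∈ lowerHalfSpace m lam := by
    have hle : x₀ (Fin.last m) ≤ lam := closure_lowerHalfSpace_subset hx₀K.1
    refine hle.lt_of_ne fun h => ?_
    have := hanti x₀
    rw [planeReflection_eq_self h] at this
    linarith
  refine ⟨x₀, by_contra fun h => (hout x₀ ⟨hx₀S, h⟩).not_gt hw₀, hw₀, fun y hy => ?_⟩
  by_cases hyK : y ∈ K
  · exact hmin hyK
  refine hle₁.trans ?_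
  by_cases hyΩ : y ∈ Ω
  · refine hR y hyΩ ?_
    by_contra h
    exact hyK ⟨subset_closure hy, by simp [(not_le.1 h).le]⟩
  · exact hτ0.le.trans (div_nonneg (hout y ⟨hy, hyΩ⟩) (hGpos y).le)

/-- Between thin, well separated slabs there is a ball of comparable size near every point. -/
lemma exists_ball_disjoint_slabs {N : ℕ} {a ℓ : Fin N → ℝ} {l d : ℝ} (hl0 : 0 < l) (hld : 3 * l ≤ d)
    (hl : ∀ i, ℓ i < l)
    (hsep : ∀ i j, i ≠ j → ∀ x ∈ openSlab m (a i) (ℓ i), ∀ y ∈ openSlab m (a j) (ℓ j),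
      d ≤ dist x y) {x : EuclideanSpace ℝ (Fin (m + 1))} (hx : x ∈ ⋃ i, openSlab m (a i) (ℓ i)) :
    ∃ b, Metric.ball b l ⊆ (⋃ i, openSlab m (a i) (ℓ i))ᶜ ∧
      ∀ y ∈ Metric.ball b l, l ≤ ‖x - y‖ ∧ ‖x - y‖ ≤ 3 * l := by
  obtain ⟨i, hi⟩ := mem_iUnion.1 hx
  set e : EuclideanSpace ℝ (Fin (m + 1)) := EuclideanSpace.single (Fin.last m) (1 : ℝ) with he
  have hne : ‖e‖ = 1 := by simp [he]
  have hel : e (Fin.last m) = 1 := by simp [he]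
  have hcoord : ∀ y ∈ Metric.ball (x + (2 * l) • e) l,
      l < y (Fin.last m) - x (Fin.last m) ∧ y (Fin.last m) - x (Fin.last m) < 3 * l := by
    intro y hy
    rw [Metric.mem_ball, dist_eq_norm] at hy
    have := (PiLp.norm_apply_le (y - (x + (2 * l) • e)) (Fin.last m)).trans_lt hy
    simp only [PiLp.sub_apply, PiLp.add_apply, PiLp.smul_apply, hel, Real.norm_eq_abs,
      smul_eq_mul, mul_one, abs_lt] at this
    constructor <;> linarith [this.1, this.2]
  refine ⟨x + (2 * l) • e, fun y hy hyS => ?_, fun y hy => ⟨?_, ?_⟩⟩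
  · obtain ⟨j, hj⟩ := mem_iUnion.1 hyS
    obtain ⟨h1, h2⟩ := hcoord y hy
    by_cases hij : i = j
    · subst hij
      linarith [hi.1, hj.2, hl i]
    -- Sliding `y` back to the height of `x` lands in slab `i`, at distance `t < 3 * l ≤ d` from
    -- `y`.
    · set t := y (Fin.last m) - x (Fin.last m) with ht
      have hmem : y - t • e ∈ openSlab m (a i) (ℓ i) := by
        have : (y - t • e) (Fin.last m) = x (Fin.last m) := by
          simp only [PiLp.sub_apply, PiLp.smul_apply, hel, smul_eq_mul, mul_one, ht]
          ring
        simpa only [openSlab, mem_ofPred_eq, this] using hi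
      have := hsep i j hij _ hmem y hj
      rw [dist_eq_norm, sub_sub_cancel_left, norm_neg, norm_smul, hne, mul_one,
        Real.norm_of_nonneg (by linarith)] at this
      linarith
  · have := PiLp.norm_apply_le (x - y) (Fin.last m)
    rw [PiLp.sub_apply, Real.norm_eq_abs] at this
    have h2 := neg_abs_le (x (Fin.last m) - y (Fin.last m))
    linarith [(hcoord y hy).1]
  · rw [Metric.mem_ball, dist_eq_norm] at hy
    have h1 : x - y = -(y - (x + (2 * l) • e)) - (2 * l) • e := by abel
    calc ‖x - y‖ ≤ ‖-(y - (x + (2 * l) • e))‖ + ‖(2 * l) • e‖ := by rw [h1]; exact norm_sub_le _ _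
      _ ≤ 3 * l := by
        rw [norm_neg, norm_smul, hne, mul_one, Real.norm_of_nonneg (by positivity)]
        linarith

/-- The truncated fractional Laplacian of the weight cut off outside a set that misses a ball. -/
lemma truncated_indicator_growthWeight_ge {p η l ε : ℝ} (hs0 : 0 < s) (hs1 : s < 1) (hη0 : 0 < η)
    (hη1 : η ≤ 1) (hp0 : 0 < p) (hps : p < s) (hl0 : 0 < l) (hηl : η * (3 * l) ≤ 1)
    {Ω : Set (EuclideanSpace ℝ (Fin (m + 1)))} (hΩ : MeasurableSet Ω)
    {x b : EuclideanSpace ℝ (Fin (m + 1))} (hb : Metric.ball b l ⊆ Ωᶜ)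
    (hbx : ∀ y ∈ Metric.ball b l, l ≤ ‖x - y‖ ∧ ‖x - y‖ ≤ 3 * l) (hε : 0 < ε) (hεl : ε ≤ l) :
    growthWeight η p x * ((3 ^ (((m + 1 : ℕ) : ℝ) + 2 * s))⁻¹ / 4 *
        volume.real (Metric.ball (0 : EuclideanSpace ℝ (Fin (m + 1))) 1) * l ^ (-(2 * s)) -
        η ^ (2 * s) * ∫ z : EuclideanSpace ℝ (Fin (m + 1)),
        (growthWeight 1 p z - 1) / ‖z‖ ^ (((m + 1 : ℕ) : ℝ) + 2 * s)) ≤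
      ∫ y in (Metric.ball x ε)ᶜ,
        (growthWeight η p x - Ω.indicator (growthWeight η p) y) /
          ‖x - y‖ ^ (((m + 1 : ℕ) : ℝ) + 2 * s) := by
  have hge := truncated_growthWeight_ge (m := m) hs0 hs1 hη0 hη1 hp0 hps x hε
  set q : ℝ := ((m + 1 : ℕ) : ℝ) + 2 * s with hq
  have hq0 : 0 < q := by positivity
  set A := ∫ z : EuclideanSpace ℝ (Fin (m + 1)), (growthWeight 1 p z - 1) / ‖z‖ ^ q with hA
  set G : EuclideanSpace ℝ (Fin (m + 1)) → ℝ := growthWeight η p with hG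
  have hGpos : ∀ y, 0 < G y := growthWeight_pos
  have hGL : MemL2s s G := memL2s_growthWeight hs0 hη0.le hη1 hp0 hps
  have i1 : IntegrableOn (fun y => (G x - G y) / ‖x - y‖ ^ q) (Metric.ball x ε)ᶜ volume := by
    refine (((memL2s_const hs0 (G x)).add (hGL.const_mul (-1))).integrableOn_div hs0 x hε).congr
      (ae_of_all _ fun y => ?_)
    simp only [neg_mul, one_mul, sub_eq_add_neg, hq]
  have i2 : IntegrableOn (fun y => Ωᶜ.indicator (fun y => G y / ‖x - y‖ ^ q) y)
      (Metric.ball x ε)ᶜ volume := (hGL.integrableOn_div hs0 x hε).indicator hΩ.compl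
  -- Removing the weight outside `Ω` adds a nonnegative term, bounded below by its part over the
  -- ball `b`.
  have hsplit : ∫ y in (Metric.ball x ε)ᶜ, (G x - Ω.indicator G y) / ‖x - y‖ ^ q =
      (∫ y in (Metric.ball x ε)ᶜ, (G x - G y) / ‖x - y‖ ^ q) +
        ∫ y in (Metric.ball x ε)ᶜ, Ωᶜ.indicator (fun y => G y / ‖x - y‖ ^ q) y := by
    rw [← integral_add i1 i2]
    congr 1 with y
    by_cases hy : y ∈ Ω
    · simp [hy]
    · simp only [hy, not_false_eq_true, indicator_of_notMem, indicator_of_mem, mem_compl_iff]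
      ring
  have hsub : Metric.ball b l ⊆ (Metric.ball x ε)ᶜ := fun y hy h => by
    rw [Metric.mem_ball, dist_eq_norm, norm_sub_rev] at h
    linarith [(hbx y hy).1]
  have hmb : MeasurableSet (Metric.ball b l) := Metric.isOpen_ball.measurableSet
  have h2 : ∫ y in Metric.ball b l, G x / 4 * ((3 * l) ^ q)⁻¹ ≤
      ∫ y in (Metric.ball x ε)ᶜ, Ωᶜ.indicator (fun y => G y / ‖x - y‖ ^ q) y := by
    refine le_trans (setIntegral_mono_on ?_ (i2.mono_set hsub) hmb fun y hy => ?_)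
      (setIntegral_mono_set i2 (ae_of_all _ fun y => ?_) hsub.eventuallyLE)
    · exact integrableOn_const measure_ball_lt_top.ne
    · obtain ⟨h3, h4⟩ := hbx y hy
      have h0 : 0 < ‖x - y‖ := hl0.trans_le h3
      rw [indicator_of_mem (hb hy), div_eq_mul_inv (G y)]
      have hG4 : G x ≤ 4 * G y := growthWeight_le_four_mul hp0.le (by linarith) (by
        rw [← mul_pow]
        have : η * ‖x - y‖ ≤ 1 := (mul_le_mul_of_nonneg_left h4 hη0.le).trans hηl
        exact pow_le_one₀ (by positivity) this)
      have := hGpos y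
      gcongr
      linarith
    · exact indicator_nonneg (fun y _ => div_nonneg (hGpos y).le (by positivity)) y
  have h3 : ∫ y in Metric.ball b l, G x / 4 * ((3 * l) ^ q)⁻¹ = G x * ((3 ^ q)⁻¹ / 4 *
        volume.real (Metric.ball (0 : EuclideanSpace ℝ (Fin (m + 1))) 1) * l ^ (-(2 * s))) := by
    rw [setIntegral_const, smul_eq_mul, measureReal_def, Measure.addHaar_ball_of_pos volume b hl0,
      finrank_euclideanSpace, Fintype.card_fin, ENNReal.toReal_mul,
      ENNReal.toReal_ofReal (by positivity), ← measureReal_def, Real.mul_rpow (by norm_num) hl0.le,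
      Real.rpow_neg hl0.le]
    have : l ^ q = l ^ (m + 1) * l ^ (2 * s) := by
      rw [hq, Real.rpow_add hl0, Real.rpow_natCast]
    rw [this]
    field_simp
  rw [hsplit, mul_sub, ← h3]
  linarith

end NarrowRegion

/-! ### Estimate at the minimum and strong maximum principle -/

section MaximumPrinciples

variable {m : ℕ} {s lam : ℝ}

/-- Upper bound for the fractional Laplacian at the minimum of `w / G`, for a weight `G` of
slow growth. -/
lemma fracLaplacian_le_of_min_div_growthWeight {p η l v : ℝ} (hs0 : 0 < s) (hs1 : s < 1)
    (hη0 : 0 < η) (hη1 : η ≤ 1) (hp0 : 0 < p) (hps : p < s) (hl0 : 0 < l) (hηl : η * (3 * l) ≤ 1)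
    {Ω : Set (EuclideanSpace ℝ (Fin (m + 1)))} (hΩ : MeasurableSet Ω)
    (hΩS : Ω ⊆ lowerHalfSpace m lam) {w : EuclideanSpace ℝ (Fin (m + 1)) → ℝ}
    (hwL : MemL2s s w) (hanti : ∀ x, w x = -w (planeReflection lam x))
    (hout : ∀ x ∈ lowerHalfSpace m lam \ Ω, 0 ≤ w x)
    {x b : EuclideanSpace ℝ (Fin (m + 1))} (hx : x ∈ Ω) (hw : w x < 0)
    (hmin : ∀ y ∈ lowerHalfSpace m lam, w x / growthWeight η p x ≤ w y / growthWeight η p y)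
    (hb : Metric.ball b l ⊆ Ωᶜ)
    (hbx : ∀ y ∈ Metric.ball b l, l ≤ ‖x - y‖ ∧ ‖x - y‖ ≤ 3 * l)
    (hlap : HasFracLaplacianAt s w x v) :
    v ≤ fracLapConst (m + 1) s * (w x * ((3 ^ (((m + 1 : ℕ) : ℝ) + 2 * s))⁻¹ / 4 *
        volume.real (Metric.ball (0 : EuclideanSpace ℝ (Fin (m + 1))) 1) * l ^ (-(2 * s)) -
        η ^ (2 * s) * ∫ z : EuclideanSpace ℝ (Fin (m + 1)),
        (growthWeight 1 p z - 1) / ‖z‖ ^ (((m + 1 : ℕ) : ℝ) + 2 * s))) := by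
  have hC : 0 < fracLapConst (m + 1) s := fracLapConst_pos hs0 hs1
  have hge := fun ε (hε : 0 < ε) (hεl : ε ≤ l) => truncated_indicator_growthWeight_ge (m := m)
    hs0 hs1 hη0 hη1 hp0 hps hl0 hηl hΩ hb hbx hε hεl
  have hGL : MemL2s s (growthWeight η p : EuclideanSpace ℝ (Fin (m + 1)) → ℝ) :=
    memL2s_growthWeight hs0 hη0.le hη1 hp0 hps
  unfold HasFracLaplacianAt at hlap
  set κ := (3 ^ (((m + 1 : ℕ) : ℝ) + 2 * s))⁻¹ / 4 *
        volume.real (Metric.ball (0 : EuclideanSpace ℝ (Fin (m + 1))) 1) * l ^ (-(2 * s)) -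
        η ^ (2 * s) * ∫ z : EuclideanSpace ℝ (Fin (m + 1)),
        (growthWeight 1 p z - 1) / ‖z‖ ^ (((m + 1 : ℕ) : ℝ) + 2 * s) with hκ
  set q : ℝ := ((m + 1 : ℕ) : ℝ) + 2 * s with hq
  set G : EuclideanSpace ℝ (Fin (m + 1)) → ℝ := growthWeight η p with hG
  have hGpos : ∀ y, 0 < G y := growthWeight_pos
  set μ := -(w x / G x) with hμ
  have hμ0 : 0 < μ := by rw [hμ, neg_pos]; exact div_neg_of_neg_of_pos hw (hGpos x)
  have hwx : w x = -(μ * G x) := by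
    rw [hμ, neg_mul, neg_neg, div_mul_cancel₀ _ (hGpos x).ne']
  set g : EuclideanSpace ℝ (Fin (m + 1)) → ℝ := Ω.indicator G with hg
  have hg0 : ∀ y, 0 ≤ g y := fun y => indicator_nonneg (fun y _ => (hGpos y).le) y
  have hgG : ∀ y, g y ≤ G y := fun y => indicator_le_self' (fun y _ => (hGpos y).le) y
  set ρ : EuclideanSpace ℝ (Fin (m + 1)) → EuclideanSpace ℝ (Fin (m + 1)) :=
    planeReflection lam with hρ
  have hgm : Measurable g := continuous_growthWeight.measurable.indicator hΩ
  have hgw : ∀ y, g y ≤ (1 + ‖y‖) ^ (2 * p) := fun y =>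
    (hgG y).trans (growthWeight_le_one_add_norm_rpow hη0.le hη1 hp0.le y)
  have hgL : MemL2s s g := by
    refine memL2s_of_abs_le (C := 1) (r := 2 * p) hs0 (by linarith) (by linarith) hgm fun y => ?_
    rw [abs_of_nonneg (hg0 y), one_mul]
    exact hgw y
  have hgρL : MemL2s s (fun y => g (ρ y)) := by
    refine memL2s_of_abs_le (C := (1 + ‖ρ 0‖) ^ (2 * p)) (r := 2 * p) hs0 (by linarith)
      (by linarith) (hgm.comp isometry_planeReflection.continuous.measurable) fun y => ?_
    rw [abs_of_nonneg (hg0 _), ← Real.mul_rpow (by positivity) (by positivity)]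
    refine (hgw _).trans (Real.rpow_le_rpow (by positivity) ?_ (by linarith))
    have h1 : ‖ρ y - ρ 0‖ = ‖y‖ := by
      rw [← dist_eq_norm, hρ, dist_planeReflection, dist_zero_right]
    have h2 : ‖ρ y‖ ≤ ‖ρ y - ρ 0‖ + ‖ρ 0‖ := by simpa using norm_add_le (ρ y - ρ 0) (ρ 0)
    nlinarith [norm_nonneg y, norm_nonneg (ρ 0)]
  -- The cut-off weight must be reflected too, to keep antisymmetry; its reflection lives above the
  -- plane and does not affect the sign of `u` below it.
  set u : EuclideanSpace ℝ (Fin (m + 1)) → ℝ :=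
    fun y => w y + μ * (g y + (-1) * g (ρ y)) with hu
  have huL : MemL2s s u := hwL.add ((hgL.add (hgρL.const_mul (-1))).const_mul μ)
  have huanti : ∀ y, u y = -u (planeReflection lam y) := fun y => by
    simp only [hu, hρ, planeReflection_planeReflection]
    rw [hanti y]; ring
  have hunn : ∀ y ∈ lowerHalfSpace m lam, 0 ≤ u y := by
    intro y hy
    have hρy : g (ρ y) = 0 := by
      refine indicator_of_notMem (fun h => ?_) _
      have h1 : ρ y (Fin.last m) < lam := hΩS h
      have h2 : y (Fin.last m) < lam := hy
      rw [hρ, planeReflection_last] at h1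
      linarith
    simp only [hu, hρy, mul_zero, add_zero]
    by_cases hyΩ : y ∈ Ω
    · have h1 := hmin y hy
      rw [le_div_iff₀ (hGpos y)] at h1
      rw [hg, indicator_of_mem hyΩ, hμ]
      linarith
    · have := hout y ⟨hy, hyΩ⟩
      have := mul_nonneg hμ0.le (hg0 y)
      linarith
  have hxS : x ∈ lowerHalfSpace m lam := hΩS hx
  set δ := ((lam - x (Fin.last m)) ^ q)⁻¹ with hδ
  have hbound : ∀ᶠ ε in 𝓝[>] (0 : ℝ), fracLapConst (m + 1) s *
      ∫ y in (Metric.ball x ε)ᶜ, (w x - w y) / ‖x - y‖ ^ q ≤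
        fracLapConst (m + 1) s * (w x * κ + δ * ∫ y in Metric.ball x ε, |u y|) := by
    filter_upwards [Ioc_mem_nhdsGT hl0] with ε hε
    gcongr
    -- No quantitative gain is needed here, so `D = ∅`.
    have hA := antisymm_truncated_integral_ge hs0 huL huanti hunn hxS hε.1 le_rfl
      MeasurableSet.empty (fun y hy => hy.elim) (empty_disjoint _)
    rw [Measure.restrict_empty, integral_zero_measure, zero_div, zero_sub] at hA
    have hB := hge ε hε.1 hε.2
    have i1 : IntegrableOn (fun y => (w x - w y) / ‖x - y‖ ^ q) (Metric.ball x ε)ᶜ volume := by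
      refine (((memL2s_const hs0 (w x)).add (hwL.const_mul (-1))).integrableOn_div hs0 x
        hε.1).congr (ae_of_all _ fun y => ?_)
      simp only [neg_mul, one_mul, sub_eq_add_neg, hq]
    have i2 : IntegrableOn (fun y => (G x - g y) / ‖x - y‖ ^ q) (Metric.ball x ε)ᶜ volume := by
      refine (((memL2s_const hs0 (G x)).add (hgL.const_mul (-1))).integrableOn_div hs0 x
        hε.1).congr (ae_of_all _ fun y => ?_)
      simp only [neg_mul, one_mul, sub_eq_add_neg, hq]
    have i3 : IntegrableOn (fun y => u y / ‖x - y‖ ^ q) (Metric.ball x ε)ᶜ volume :=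
      huL.integrableOn_div hs0 x hε.1
    -- The reflected term `μ * g (ρ y)` enters with a favourable sign and is dropped.
    have hmono := integral_mono i1 ((i2.const_mul (-μ)).sub i3) fun y => by
      simp only [Pi.sub_apply]
      rw [mul_div_assoc', ← sub_div]
      refine div_le_div_of_nonneg_right ?_ (by positivity)
      have := mul_nonneg hμ0.le (hg0 (ρ y))
      simp only [hu]
      rw [hwx]
      linarith
    simp only [Pi.sub_apply] at hmono
    rw [integral_sub (i2.const_mul (-μ)) i3, integral_const_mul] at hmono
    have hB' := mul_le_mul_of_nonneg_left hB hμ0.le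
    have : w x * κ = -(μ * (G x * κ)) := by rw [hwx]; ring
    linarith
  have hlim : Tendsto (fun ε : ℝ => fracLapConst (m + 1) s *
      (w x * κ + δ * ∫ y in Metric.ball x ε, |u y|)) (𝓝[>] 0)
      (𝓝 (fracLapConst (m + 1) s * (w x * κ))) := by
    simpa using (((tendsto_setIntegral_abs_ball huL.1 x).const_mul δ).const_add
      (w x * κ)).const_mul (fracLapConst (m + 1) s)
  exact le_of_tendsto_of_tendsto hlap hlim hbound

/-- Strong maximum principle for antisymmetric functions. -/
lemma antisymm_eq_zero_of_fracLaplacian_eq_zero (hs0 : 0 < s) (hs1 : s < 1)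
    {w : EuclideanSpace ℝ (Fin (m + 1)) → ℝ} (hwL : MemL2s s w)
    (hlsc : LowerSemicontinuousOn w (closure (lowerHalfSpace m lam)))
    (hanti : ∀ x, w x = -w (planeReflection lam x))
    (hnn : ∀ x ∈ lowerHalfSpace m lam, 0 ≤ w x)
    {z : EuclideanSpace ℝ (Fin (m + 1))} (hz : z ∈ lowerHalfSpace m lam) (hwz : w z = 0)
    (hlap : HasFracLaplacianAt s w z 0) (x : EuclideanSpace ℝ (Fin (m + 1))) : w x = 0 := by
  have hC : 0 < fracLapConst (m + 1) s := fracLapConst_pos hs0 hs1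
  have hρS : ∀ y ∈ lowerHalfSpace m lam, planeReflection lam y ∉ lowerHalfSpace m lam := by
    intro y hy h
    have h1 : y (Fin.last m) < lam := hy
    have h2 : planeReflection lam y (Fin.last m) < lam := h
    rw [planeReflection_last] at h2
    linarith
  have hS : ∀ y ∈ lowerHalfSpace m lam, w y = 0 := by
    intro y₀ hy₀
    by_contra hne
    have hpos : 0 < w y₀ := (hnn y₀ hy₀).lt_of_ne' hne
    have hzy : z ≠ y₀ := fun h => by rw [← h, hwz] at hpos; exact hpos.false
    have hev : ∀ᶠ y in 𝓝 y₀, y ∈ lowerHalfSpace m lam ∧ 0 < w y := by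
      have hS := isOpen_lowerHalfSpace.mem_nhds hy₀
      have := hlsc y₀ (subset_closure hy₀) 0 hpos
      rw [nhdsWithin_eq_nhds.2 (mem_of_superset hS subset_closure)] at this
      exact (eventually_mem_set.2 hS).and this
    obtain ⟨r₁, hr₁, hball⟩ := Metric.eventually_nhds_iff_ball.1 hev
    obtain ⟨r₂, hr₂, hz₂⟩ := Metric.isOpen_iff.1 (isOpen_lowerHalfSpace (lam := lam)) z hz
    have hd : 0 < dist y₀ z / 2 := half_pos (dist_pos.2 hzy.symm)
    set r := min r₁ (dist y₀ z / 2) with hr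
    set ε₀ := min r₂ (dist y₀ z / 2) with hε₀
    have hr0 : 0 < r := lt_min hr₁ hd
    have hε₀0 : 0 < ε₀ := lt_min hr₂ hd
    set B := Metric.ball y₀ r with hB
    have hB' : ∀ y ∈ B, y ∈ lowerHalfSpace m lam ∧ 0 < w y := fun y hy =>
      hball y (Metric.ball_subset_ball (min_le_left _ _) hy)
    -- The positivity ball together with its mirror image: symmetric, and away from `z` because `z`
    -- lies strictly below the plane.
    set D := B ∪ planeReflection lam ⁻¹' B with hD
    have hDm : MeasurableSet D := Metric.isOpen_ball.measurableSet.union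
      (measurePreserving_planeReflection.measurable Metric.isOpen_ball.measurableSet)
    have hDs : ∀ y ∈ D, planeReflection lam y ∈ D := by
      rintro y (hy | hy)
      · exact Or.inr (by simpa only [mem_preimage, planeReflection_planeReflection] using hy)
      · exact Or.inl hy
    have hDb : Disjoint D (Metric.ball z ε₀) := by
      rw [disjoint_left]
      rintro y (hy | hy) hyz
      · have h1 := Metric.mem_ball'.1 (Metric.ball_subset_ball (min_le_right _ _) hy)
        have h2 := Metric.mem_ball.1 (Metric.ball_subset_ball (min_le_right _ _) hyz)
        linarith [dist_triangle y₀ y z]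
      · exact hρS y (hz₂ (Metric.ball_subset_ball (min_le_left _ _) hyz)) (hB' _ hy).1
    set q : ℝ := ((m + 1 : ℕ) : ℝ) + 2 * s with hq
    have hq0 : 0 < q := by positivity
    set F : EuclideanSpace ℝ (Fin (m + 1)) → ℝ := fun y => w y *
      ((‖z - y‖ ^ q)⁻¹ - (‖z - planeReflection lam y‖ ^ q)⁻¹) with hF
    have hFB : ∀ y ∈ B, 0 < F y := by
      intro y hy
      have h1 : 0 < ‖z - y‖ := norm_pos_iff.2 (sub_ne_zero.2 fun h => by
        have := (hB' y hy).2
        rw [← h, hwz] at this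
        exact this.false)
      have h2 := norm_sub_lt_norm_sub_planeReflection hz (hB' y hy).1
      refine mul_pos (hB' y hy).2 (sub_pos.2 ?_)
      gcongr
    have hFD : ∀ y ∈ D, 0 < F y := by
      rintro y (hy | hy)
      · exact hFB y hy
      · have h1 := hFB _ hy
        simp only [hF, planeReflection_planeReflection] at h1 ⊢
        rw [hanti y]
        linarith
    have hFi : IntegrableOn F D volume := antisymm_integrableOn hs0 hwL hanti hε₀0 hDs hDb
    have hI : 0 < ∫ y in D, F y := by
      rw [setIntegral_pos_iff_support_of_nonneg_ae
        ((ae_restrict_mem hDm).mono fun y hy => (hFD y hy).le) hFi]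
      refine (Metric.isOpen_ball.measure_pos volume ⟨y₀, Metric.mem_ball_self hr0⟩).trans_le
        (measure_mono fun y hy => ⟨(hFB y hy).ne', Or.inl hy⟩)
    set δ := ((lam - z (Fin.last m)) ^ q)⁻¹ with hδ
    have hbound : ∀ᶠ ε in 𝓝[>] (0 : ℝ), fracLapConst (m + 1) s *
        ∫ y in (Metric.ball z ε)ᶜ, (w z - w y) / ‖z - y‖ ^ q ≤
          fracLapConst (m + 1) s * (-((∫ y in D, F y) / 2) +
            δ * ∫ y in Metric.ball z ε, |w y|) := by
      filter_upwards [Ioc_mem_nhdsGT hε₀0] with ε hε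
      gcongr
      have hA := antisymm_truncated_integral_ge hs0 hwL hanti hnn hz hε.1 hε.2 hDm hDs hDb
      simp_rw [hwz, zero_sub, neg_div]
      rw [integral_neg]
      linarith
    have hlim : Tendsto (fun ε : ℝ => fracLapConst (m + 1) s * (-((∫ y in D, F y) / 2) +
        δ * ∫ y in Metric.ball z ε, |w y|)) (𝓝[>] 0)
        (𝓝 (fracLapConst (m + 1) s * (-((∫ y in D, F y) / 2)))) := by
      simpa using (((tendsto_setIntegral_abs_ball hwL.1 z).const_mul δ).const_add
        (-((∫ y in D, F y) / 2))).const_mul (fracLapConst (m + 1) s)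
    have := le_of_tendsto_of_tendsto hlap hlim hbound
    nlinarith [mul_pos hC hI]
  rcases lt_trichotomy (x (Fin.last m)) lam with h | h | h
  · exact hS x h
  · have := hanti x
    rw [planeReflection_eq_self h] at this
    linarith
  · rw [hanti x, hS (planeReflection lam x), neg_zero]
    show planeReflection lam x (Fin.last m) < lam
    rw [planeReflection_last]
    linarith

end MaximumPrinciples

theorem theorem1p4 (m : ℕ) (s : ℝ) (hs0 : 0 < s) (hs1 : s < 1)
    (M d : ℝ) (hd : 0 < d) :
    ∃ l : ℝ, 0 < l ∧
      ∀ (lam : ℝ) (N : ℕ) (a ℓ : Fin N → ℝ)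
        (Ω : Set (EuclideanSpace ℝ (Fin (m + 1))))
        (c w : EuclideanSpace ℝ (Fin (m + 1)) → ℝ) (C₀ γ : ℝ),
        -- the slabs: positive widths below the threshold, mutual distances at least `d`
        (∀ i, 0 < ℓ i) →
        (∀ i, ℓ i < l) →
        (∀ i j, i ≠ j → ∀ x ∈ openSlab m (a i) (ℓ i), ∀ y ∈ openSlab m (a j) (ℓ j),
          d ≤ dist x y) →
        -- the open set `Ω`
        IsOpen Ω →
        Ω ⊆ lowerHalfSpace m lam →
        Ω ⊆ ⋃ i, openSlab m (a i) (ℓ i) →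
        -- the coefficient
        (∀ x ∈ Ω, c x ≤ M) →
        -- the function `w`
        MemL2s s w →
        LowerSemicontinuousOn w (closure (lowerHalfSpace m lam)) →
        (∀ x, w x = - w (planeReflection lam x)) →
        (∀ x ∈ Ω, w x < 0 → HasFracLaplacianAt s w x (c x * w x)) →
        (∀ x ∈ lowerHalfSpace m lam \ Ω, 0 ≤ w x) →
        0 < γ → γ < 2 * s →
        (∀ x ∈ Ω, - C₀ * (1 + ‖x‖ ^ γ) ≤ w x) →
        (∀ x ∈ lowerHalfSpace m lam, 0 ≤ w x) ∧
          ((∃ z ∈ lowerHalfSpace m lam, w z = 0 ∧ HasFracLaplacianAt s w z (c z * w z)) →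
            ∀ x, w x = 0) := by
  have hC : 0 < fracLapConst (m + 1) s := fracLapConst_pos hs0 hs1
  -- Of the 2, one unit absorbs the weight's cost η^(2s) A < 1 and the other gives the strict
  -- contradiction; `l ≤ d / 3` serves the ball between slabs.
  obtain ⟨l, hlarge, hl0, hld⟩ : ∃ l : ℝ, |M| / fracLapConst (m + 1) s + 2 ≤
      (3 ^ (((m + 1 : ℕ) : ℝ) + 2 * s))⁻¹ / 4 *
        volume.real (Metric.ball (0 : EuclideanSpace ℝ (Fin (m + 1))) 1) * l ^ (-(2 * s)) ∧
      0 < l ∧ l ≤ d / 3 := by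
    have hω : 0 < volume.real (Metric.ball (0 : EuclideanSpace ℝ (Fin (m + 1))) 1) :=
      ENNReal.toReal_pos (Metric.measure_ball_pos _ _ one_pos).ne' measure_ball_lt_top.ne
    have ht : Tendsto (fun l : ℝ => (3 ^ (((m + 1 : ℕ) : ℝ) + 2 * s))⁻¹ / 4 *
        volume.real (Metric.ball (0 : EuclideanSpace ℝ (Fin (m + 1))) 1) * l ^ (-(2 * s)))
        (𝓝[>] 0) atTop :=
      (tendsto_rpow_neg_nhdsGT_zero (by linarith)).const_mul_atTop (by positivity)
    obtain ⟨l, h1, h2⟩ := ((ht.eventually_ge_atTop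
      (|M| / fracLapConst (m + 1) s + 2)).and (Ioc_mem_nhdsGT (by positivity : 0 < d / 3))).exists
    exact ⟨l, h1, h2.1, h2.2⟩
  refine ⟨l, hl0, fun lam N a ℓ Ω c w C₀ γ _ hl hsep hΩ hΩS hΩslab hc hwL hlsc hanti heq hout
    hγ0 hγs hgrow => ?_⟩
  have hnn : ∀ x ∈ lowerHalfSpace m lam, 0 ≤ w x := by
    intro x₁ hx₁
    by_contra! hw₁
    -- The midpoint of γ/2 and s.
    set p := (γ / 2 + s) / 2 with hp
    have hp0 : 0 < p := by positivity
    have hps : p < s := by linarith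
    set A := ∫ z : EuclideanSpace ℝ (Fin (m + 1)),
        (growthWeight 1 p z - 1) / ‖z‖ ^ (((m + 1 : ℕ) : ℝ) + 2 * s) with hA
    obtain ⟨η, hηA, hη0, hη⟩ : ∃ η : ℝ, η ^ (2 * s) * A < 1 ∧ 0 < η ∧ η ≤ min 1 (1 / (3 * l)) := by
      have ht : Tendsto (fun η : ℝ => η ^ (2 * s) * A) (𝓝[>] 0) (𝓝 0) := by
        have h1 : Tendsto (fun η : ℝ => η ^ (2 * s)) (𝓝[>] 0) (𝓝 0) := by
          have := (Real.continuousAt_rpow_const 0 (2 * s) (Or.inr (by linarith))).tendsto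
          rw [Real.zero_rpow (by linarith)] at this
          exact this.mono_left nhdsWithin_le_nhds
        simpa using h1.mul_const A
      obtain ⟨η, h1, h2⟩ := ((ht.eventually_lt_const one_pos).and
        (Ioc_mem_nhdsGT (by positivity : 0 < min 1 (1 / (3 * l))))).exists
      exact ⟨η, h1, h2.1, h2.2⟩
    have hη1 : η ≤ 1 := hη.trans (min_le_left _ _)
    have hηl : η * (3 * l) ≤ 1 := (le_div_iff₀ (by positivity)).1 (hη.trans (min_le_right _ _))
    obtain ⟨x₀, hx₀, hw₀, hmin⟩ := exists_min_div_growthWeight (p := p) hη0 (by linarith) hγ0 hlsc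
      hanti hout hgrow hx₁ hw₁
    obtain ⟨b, hb, hbx⟩ := exists_ball_disjoint_slabs hl0 (by linarith) hl hsep (hΩslab hx₀)
    have hle := fracLaplacian_le_of_min_div_growthWeight hs0 hs1 hη0 hη1 hp0 hps hl0 hηl
      hΩ.measurableSet hΩS hwL hanti hout hx₀ hw₀ hmin (hb.trans (compl_subset_compl.2 hΩslab)) hbx
      (heq x₀ hx₀ hw₀)
    rw [← hA] at hle
    have hcM : |M| * w x₀ ≤ c x₀ * w x₀ :=
      mul_le_mul_of_nonpos_right ((hc x₀ hx₀).trans (le_abs_self M)) hw₀.le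
    have hCM : |M| + fracLapConst (m + 1) s ≤ fracLapConst (m + 1) s *
        ((3 ^ (((m + 1 : ℕ) : ℝ) + 2 * s))⁻¹ / 4 *
        volume.real (Metric.ball (0 : EuclideanSpace ℝ (Fin (m + 1))) 1) * l ^ (-(2 * s)) -
        η ^ (2 * s) * A) := by
      have h1 : |M| + fracLapConst (m + 1) s =
          fracLapConst (m + 1) s * (|M| / fracLapConst (m + 1) s + 1) := by field_simp
      rw [h1]
      gcongr
      linarith
    have := mul_le_mul_of_nonpos_right hCM hw₀.le
    nlinarith [mul_neg_of_pos_of_neg hC hw₀]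
  refine ⟨hnn, ?_⟩
  rintro ⟨z, hz, hwz, hlap⟩
  rw [hwz, mul_zero] at hlap
  exact antisymm_eq_zero_of_fracLaplacian_eq_zero hs0 hs1 hwL hlsc hanti hnn hz hwz hlap
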